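/- Let $\mathbb{D}=\{z\in\mathbb{C}:|z|<1\}$ and $dA=\frac1\pi\,dx\,dy$, and for a function $f$ holomorphic in $\mathbb{D}$ put $I(f)=\int_{\mathbb{D}}|f'(z)|\,dA(z)\in[0,\infty]$. For an integer $n\ge 1$, a finite Blaschke product of degree $n$ is a function on $\mathbb{D}$ of the form $$B(z)=u\prod_{k=1}^{n}\frac{a_k-z}{1-\overline{a_k}\,z},\qquad |u|=1,\quad a_1,\dots,a_n\in\mathbb{D}$$ (the $a_k$ need not be distinct). Then the following hold. (1) For every $n\ge 1$, every finite Blaschke product $B$ of degree $n$ satisfies $$I(B)\le \pi\bigl(1+\sqrt{\log n}\bigr).$$ (2) There is an absolute constant $c>0$ such that for every $n\ge 1$ there exists a finite Blaschke product $B$ of degree $n$ with $$I(B)\ge c\bigl(1+\sqrt{\log n}\bigr).$$ -/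

import Mathlib

open scoped ENNReal ComplexConjugate

/-- `B` is a finite Blaschke product of degree `n`: on the open unit disk it is the product of a
unimodular constant `u` and of `n` factors `(a k - z) / (1 - conj (a k) * z)` with zeros `a k`
(repeated according to multiplicity) in the open unit disk. Nothing is required of the values of
`B` outside the disk. -/
def IsFiniteBlaschkeProduct (n : ℕ) (B : ℂ → ℂ) : Prop :=
  ∃ (u : ℂ) (a : Fin n → ℂ), ‖u‖ = 1 ∧ (∀ k, ‖a k‖ < 1) ∧
    ∀ z ∈ Metric.ball (0 : ℂ) 1, B z = u * ∏ k, (a k - z) / (1 - conj (a k) * z)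

/-- The normalized area measure `dA = dx dy / π` on the complex plane. -/
noncomputable def normalizedArea : MeasureTheory.Measure ℂ :=
  ENNReal.ofReal (1 / Real.pi) • MeasureTheory.volume

/-- `I(f) = ∫_{|z| < 1} |f'(z)| dA(z)`, as an element of `[0, ∞]`; it is meant for functions `f`
holomorphic in the open unit disk. -/
noncomputable def derivIntegral (f : ℂ → ℂ) : ℝ≥0∞ :=
  ∫⁻ z in Metric.ball (0 : ℂ) 1, ‖deriv f z‖ₑ ∂normalizedArea

open MeasureTheory Set Filter Topology

/-! Upper bound: cut the disk at the radius `r` with `1 - r² = 1/n`. Inside, Cauchy-Schwarz with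
weight `1 - |z|²` pairs `∫ |B'|² (1 - |z|²) ≤ π`, valid for every holomorphic function bounded by
one (Parseval), with `∫ 1 / (1 - |z|²) = π log n`. Outside, `|B'|` is at most the sum of the moduli
of the derivatives of the `n` factors, and each of these integrates to at most the area `π / n` of
the annulus. Dividing by `π` gives `1 + √(log n)`, better than required.

Lower bound: by Cauchy's formula the coefficient at `4 ^ j` controls `∫ |f'|` over a ring at
distance about `4 ^ (-j)` from the unit circle. These rings are disjoint, so `I(f)` dominates the
sum of the `|b (4 ^ j)|`. It remains to find a Blaschke product with about `log n` such
coefficients, each of size about `1 / √(log n)`. A Rudin-Shapiro type recursion (`lacunaryPair`)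
yields a polynomial bounded by one on the circle with these coefficients. With `p` half of it and
`p*` the reflection of `p` in degree `n`, the quotient `(z ^ n + p) / (1 + p*)` is a Blaschke
product of degree `n` that agrees with `p` to high order at `0`. -/

/-! ### Polar coordinates and Parseval's identity. -/

/-- Integration in polar coordinates over a radial set. -/
theorem lintegral_norm_mem_eq_polar {S : Set ℝ} (hS : MeasurableSet S) {G : ℂ → ℝ≥0∞}
    (hG : Measurable G) :
    ∫⁻ z in {z : ℂ | ‖z‖ ∈ S}, G z =
      ∫⁻ ρ in S ∩ Ioi 0, ENNReal.ofReal ρ *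
        ∫⁻ θ in Ioo (-Real.pi) Real.pi, G (circleMap 0 ρ θ) := by
  have hT : MeasurableSet {z : ℂ | ‖z‖ ∈ S} := measurable_norm hS
  have hpolar : ∀ p : ℝ × ℝ, Complex.polarCoord.symm p = circleMap 0 p.1 p.2 := by
    intro p
    rw [Complex.polarCoord_symm_apply, circleMap, zero_add, Complex.exp_mul_I]
    push_cast
    rfl
  have hcont : Continuous fun p : ℝ × ℝ => circleMap 0 p.1 p.2 := by
    unfold circleMap
    fun_prop
  rw [← lintegral_indicator hT, ← Complex.lintegral_comp_polarCoord_symm]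
  have htarget : polarCoord.target = Ioi (0 : ℝ) ×ˢ Ioo (-Real.pi) Real.pi := rfl
  simp_rw [hpolar, htarget, smul_eq_mul]
  rw [Measure.volume_eq_prod, ← Measure.prod_restrict, lintegral_prod]
  · rw [← Measure.restrict_restrict hS, ← lintegral_indicator hS]
    refine setLIntegral_congr_fun measurableSet_Ioi fun ρ hρ => ?_
    have hnorm : ∀ θ, ‖circleMap 0 ρ θ‖ = ρ := fun θ => by
      rw [norm_circleMap_zero, abs_of_pos hρ]
    by_cases h : ρ ∈ S
    · rw [indicator_of_mem h, ← lintegral_const_mul _ (by fun_prop)]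
      refine lintegral_congr fun θ => ?_
      rw [indicator_of_mem (by simpa [hnorm] using h)]
    · rw [indicator_of_notMem h]
      refine lintegral_eq_zero_of_ae_eq_zero (Eventually.of_forall fun θ => ?_)
      simp [hnorm, h]
  · exact ((ENNReal.measurable_ofReal.comp measurable_fst).mul
      ((hG.indicator hT).comp hcont.measurable)).aemeasurable

/-- Parseval's identity for absolutely convergent trigonometric series with nonnegative
frequencies. -/
theorem hasSum_sq_norm_of_hasSum_exp {a : ℕ → ℂ} (ha : Summable fun k => ‖a k‖) {g : ℝ → ℂ}
    (hg : ∀ θ, HasSum (fun k => a k * circleMap 0 1 θ ^ k) (g θ)) :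
    HasSum (fun k => ‖a k‖ ^ 2) ((2 * Real.pi)⁻¹ * ∫ θ in (0)..(2 * Real.pi), ‖g θ‖ ^ 2) := by
  have hsq : Summable fun k => ‖a k‖ ^ 2 := by
    refine Summable.of_norm_bounded_eventually_nat ha ?_
    filter_upwards [ha.tendsto_atTop_zero.eventually_le_const zero_lt_one] with k hk
    rw [Real.norm_of_nonneg (by positivity), sq]
    exact mul_le_of_le_one_left (norm_nonneg _) hk
  refine (hsq.hasSum_iff_tendsto_nat).2 ?_
  -- Parseval is known for polynomials; it passes to the limit by dominated convergence with bound
  -- `(∑ ‖a k‖)²`.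
  let q : ℕ → Polynomial ℂ := fun N => ∑ k ∈ Finset.range N, Polynomial.monomial k (a k)
  have hcoeff : ∀ N i, (q N).coeff i = if i < N then a i else 0 := fun N i => by
    simp [q, Polynomial.coeff_monomial]
  have heval : ∀ N z, (q N).eval z = ∑ k ∈ Finset.range N, a k * z ^ k := fun N z => by
    simp [q, Polynomial.eval_finsetSum]
  have hpars : ∀ N, ∑ k ∈ Finset.range N, ‖a k‖ ^ 2 = (2 * Real.pi)⁻¹ *
      ∫ θ in (0)..(2 * Real.pi), ‖(q N).eval (circleMap 0 1 θ)‖ ^ 2 := fun N => by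
    have h := (q N).sum_sq_norm_coeff_eq_circleAverage
    rw [Real.circleAverage, smul_eq_mul] at h
    rw [← h]
    symm
    calc ∑ i ∈ (q N).support, ‖(q N).coeff i‖ ^ 2
        = ∑ i ∈ Finset.range N, ‖(q N).coeff i‖ ^ 2 := by
          refine Finset.sum_subset (fun i hi => ?_) fun i _ hi => ?_
          · rw [Polynomial.mem_support_iff, hcoeff] at hi
            by_contra h'
            simp_all
          · simp [Polynomial.notMem_support_iff.1 hi]
      _ = _ := Finset.sum_congr rfl fun i hi => by rw [hcoeff, if_pos (Finset.mem_range.1 hi)]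
  simp_rw [hpars]
  refine Tendsto.const_mul _ ?_
  refine intervalIntegral.tendsto_integral_filter_of_dominated_convergence
    (fun _ => (∑' k, ‖a k‖) ^ 2) ?_ ?_ (by simp) ?_
  · refine Eventually.of_forall fun N => Continuous.aestronglyMeasurable ?_
    have := (q N).continuous
    have := continuous_circleMap 0 1
    fun_prop
  · refine Eventually.of_forall fun N => Eventually.of_forall fun θ _ => ?_
    rw [Real.norm_of_nonneg (by positivity), heval]
    gcongr
    refine (norm_sum_le _ _).trans ?_
    simp only [norm_mul, norm_pow, norm_circleMap_zero, abs_one, one_pow, mul_one]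
    exact ha.sum_le_tsum _ fun _ _ => norm_nonneg _
  · refine Eventually.of_forall fun θ _ => ?_
    simp_rw [heval]
    exact ((hg θ).tendsto_sum_nat.norm).pow 2

/-- The circle integral of the squared norm of a convergent power series. -/
theorem lintegral_circle_sq_enorm {a : ℕ → ℂ} {f : ℂ → ℂ} {ρ : ℝ} (hρ : 0 ≤ ρ)
    (ha : Summable fun k => ‖a k‖ * ρ ^ k)
    (hf : ∀ z : ℂ, ‖z‖ = ρ → HasSum (fun k => a k * z ^ k) (f z))
    (hc : ContinuousOn f (Metric.sphere 0 ρ)) :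
    ∫⁻ θ in Ioo (-Real.pi) Real.pi, ‖f (circleMap 0 ρ θ)‖ₑ ^ 2 =
      ENNReal.ofReal (2 * Real.pi) * ∑' k, ENNReal.ofReal (‖a k‖ ^ 2 * ρ ^ (2 * k)) := by
  have hnorm : ∀ θ, ‖circleMap 0 ρ θ‖ = ρ := fun θ => by
    rw [norm_circleMap_zero, abs_of_nonneg hρ]
  have hcont : Continuous fun θ => ‖f (circleMap 0 ρ θ)‖ ^ 2 := by
    refine (Continuous.norm ?_).pow 2
    refine hc.comp_continuous (continuous_circleMap 0 ρ) fun θ => ?_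
    simp [hnorm]
  have h := hasSum_sq_norm_of_hasSum_exp (a := fun k => a k * (ρ : ℂ) ^ k)
    (g := fun θ => f (circleMap 0 ρ θ)) (by simpa [abs_of_nonneg hρ] using ha) fun θ => by
      convert hf _ (hnorm θ) using 2 with k
      simp [circleMap, mul_pow, mul_assoc]
  have hterm : ∀ k, ‖a k * (ρ : ℂ) ^ k‖ ^ 2 = ‖a k‖ ^ 2 * ρ ^ (2 * k) := fun k => by
    rw [norm_mul, norm_pow, Complex.norm_real, Real.norm_of_nonneg hρ, mul_pow, ← pow_mul,
      mul_comm k]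
  simp_rw [hterm] at h
  have hper : ∫ θ in (0)..(2 * Real.pi), ‖f (circleMap 0 ρ θ)‖ ^ 2 =
      ∫ θ in (-Real.pi)..Real.pi, ‖f (circleMap 0 ρ θ)‖ ^ 2 := by
    have hp : Function.Periodic (fun θ => ‖f (circleMap 0 ρ θ)‖ ^ 2) (2 * Real.pi) := fun θ => by
      simp only [periodic_circleMap 0 ρ θ]
    have := hp.intervalIntegral_add_eq 0 (-Real.pi)
    rw [zero_add] at this
    rw [this]
    congr 1
    ring
  rw [← ENNReal.ofReal_tsum_of_nonneg (fun k => by positivity) h.summable, h.tsum_eq, hper,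
    ← ENNReal.ofReal_mul (by positivity), mul_inv_cancel_left₀ (by positivity),
    intervalIntegral.integral_of_le (by linarith [Real.pi_pos]), integral_Ioc_eq_integral_Ioo,
    ofReal_integral_eq_lintegral_ofReal
      (hcont.integrableOn_Icc.mono_set Ioo_subset_Icc_self)
      (Eventually.of_forall fun θ => by positivity)]
  refine lintegral_congr fun θ => ?_
  rw [← ofReal_norm, ENNReal.ofReal_pow (norm_nonneg _)]

/-- Fundamental theorem of calculus for the Lebesgue integral of a nonnegative derivative. -/
theorem setLIntegral_Ioo_ofReal_eq_sub {a b : ℝ} (hab : a ≤ b) {F f : ℝ → ℝ}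
    (hF : ∀ x ∈ Icc a b, HasDerivAt F (f x) x) (hf : ContinuousOn f (Icc a b))
    (hpos : ∀ x ∈ Ioo a b, 0 ≤ f x) :
    ∫⁻ x in Ioo a b, ENNReal.ofReal (f x) = ENNReal.ofReal (F b - F a) := by
  have hint : IntervalIntegrable f volume a b := by
    refine ContinuousOn.intervalIntegrable ?_
    rwa [uIcc_of_le hab]
  rw [← intervalIntegral.integral_eq_sub_of_hasDerivAt (by rwa [uIcc_of_le hab]) hint,
    intervalIntegral.integral_of_le hab, integral_Ioc_eq_integral_Ioo,
    ofReal_integral_eq_lintegral_ofReal (hf.integrableOn_Icc.mono_set Ioo_subset_Icc_self)]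
  exact (ae_restrict_iff' measurableSet_Ioo).2 (Eventually.of_forall hpos)

/-! ### Taylor coefficients and the weighted Dirichlet integral. -/

/-- The Taylor coefficients at the origin. -/
noncomputable def taylorCoeff (f : ℂ → ℂ) (k : ℕ) : ℂ := (k.factorial : ℂ)⁻¹ * iteratedDeriv k f 0

theorem hasSum_taylorCoeff {f : ℂ → ℂ} (hf : DifferentiableOn ℂ f (Metric.ball 0 1)) {z : ℂ}
    (hz : ‖z‖ < 1) : HasSum (fun k => taylorCoeff f k * z ^ k) (f z) := by
  have h := Complex.hasSum_taylorSeries_on_ball hf (mem_ball_zero_iff.2 hz)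
  simpa only [taylorCoeff, sub_zero, smul_eq_mul, mul_assoc, mul_comm (z ^ _)] using h

theorem summable_norm_taylorCoeff_mul_pow {f : ℂ → ℂ}
    (hf : DifferentiableOn ℂ f (Metric.ball 0 1)) {ρ : ℝ} (h0 : 0 ≤ ρ) (h1 : ρ < 1) :
    Summable fun k => ‖taylorCoeff f k‖ * ρ ^ k := by
  have hz : ‖(ρ : ℂ)‖ < 1 := by rwa [Complex.norm_real, Real.norm_of_nonneg h0]
  simpa [abs_of_nonneg h0] using (hasSum_taylorCoeff hf hz).summable.norm

theorem taylorCoeff_deriv (f : ℂ → ℂ) (k : ℕ) :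
    taylorCoeff (deriv f) k = (k + 1) * taylorCoeff f (k + 1) := by
  have h : (k : ℂ) + 1 ≠ 0 := by exact_mod_cast k.succ_ne_zero
  rw [taylorCoeff, taylorCoeff, ← iteratedDeriv_succ', Nat.factorial_succ]
  push_cast
  field_simp

theorem lintegral_circle_sq_enorm_taylorCoeff {f : ℂ → ℂ}
    (hf : DifferentiableOn ℂ f (Metric.ball 0 1)) {ρ : ℝ} (h0 : 0 ≤ ρ) (h1 : ρ < 1) :
    ∫⁻ θ in Ioo (-Real.pi) Real.pi, ‖f (circleMap 0 ρ θ)‖ₑ ^ 2 =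
      ENNReal.ofReal (2 * Real.pi) *
        ∑' k, ENNReal.ofReal (‖taylorCoeff f k‖ ^ 2 * ρ ^ (2 * k)) :=
  lintegral_circle_sq_enorm h0 (summable_norm_taylorCoeff_mul_pow hf h0 h1)
    (fun _ hz => hasSum_taylorCoeff hf (hz.trans_lt h1))
    (hf.continuousOn.mono fun z hz => by simp_all)

/-- The Taylor coefficients of a function bounded by one have square sum at most one. -/
theorem tsum_sq_taylorCoeff_le_one {f : ℂ → ℂ} (hf : DifferentiableOn ℂ f (Metric.ball 0 1))
    (hb : ∀ z : ℂ, ‖z‖ < 1 → ‖f z‖ ≤ 1) :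
    ∑' k, ENNReal.ofReal (‖taylorCoeff f k‖ ^ 2) ≤ 1 := by
  rw [ENNReal.tsum_eq_iSup_sum]
  refine iSup_le fun s => ?_
  have key : ∀ ρ ∈ Ioo (0 : ℝ) 1, ∑ k ∈ s, ENNReal.ofReal (‖taylorCoeff f k‖ ^ 2 * ρ ^ (2 * k)) ≤
      1 := fun ρ hρ => by
    have hpi : ENNReal.ofReal (2 * Real.pi) ≠ 0 := by
      simpa using Real.pi_pos
    refine (ENNReal.sum_le_tsum s).trans ?_
    rw [← ENNReal.mul_le_mul_iff_right hpi ENNReal.ofReal_ne_top,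
      ← lintegral_circle_sq_enorm_taylorCoeff hf hρ.1.le hρ.2]
    calc ∫⁻ θ in Ioo (-Real.pi) Real.pi, ‖f (circleMap 0 ρ θ)‖ₑ ^ 2
        ≤ ∫⁻ _ in Ioo (-Real.pi) Real.pi, 1 := by
          refine lintegral_mono fun θ => ?_
          refine pow_le_one' ?_ _
          rw [← ofReal_norm]
          refine ENNReal.ofReal_le_one.2 (hb _ ?_)
          rw [norm_circleMap_zero, abs_of_pos hρ.1]
          exact hρ.2
      _ = ENNReal.ofReal (2 * Real.pi) * 1 := by
          rw [setLIntegral_const, Real.volume_Ioo, one_mul, mul_one]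
          congr 1
          ring
  have hlim : Tendsto (fun ρ : ℝ => ∑ k ∈ s,
      ENNReal.ofReal (‖taylorCoeff f k‖ ^ 2 * ρ ^ (2 * k))) (𝓝[<] 1)
      (𝓝 (∑ k ∈ s, ENNReal.ofReal (‖taylorCoeff f k‖ ^ 2))) := by
    refine tendsto_nhdsWithin_of_tendsto_nhds (tendsto_finsetSum _ fun k _ => ?_)
    refine ENNReal.tendsto_ofReal ?_
    have : Continuous fun ρ : ℝ => ‖taylorCoeff f k‖ ^ 2 * ρ ^ (2 * k) := by fun_prop
    simpa using this.tendsto 1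
  refine le_of_tendsto hlim ?_
  filter_upwards [Ioo_mem_nhdsLT (zero_lt_one' ℝ)] with ρ hρ using key ρ hρ

theorem setOf_norm_mem_Ico : {z : ℂ | ‖z‖ ∈ Ico (0 : ℝ) 1} = Metric.ball 0 1 := by
  ext z
  simp

/-- The weighted Dirichlet integral of a function bounded by one. -/
theorem lintegral_sq_deriv_mul_le {f : ℂ → ℂ} (hf : DifferentiableOn ℂ f (Metric.ball 0 1))
    (hb : ∀ z : ℂ, ‖z‖ < 1 → ‖f z‖ ≤ 1) :
    ∫⁻ z in Metric.ball 0 1, ‖deriv f z‖ₑ ^ 2 * ENNReal.ofReal (1 - ‖z‖ ^ 2) ≤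
      ENNReal.ofReal Real.pi := by
  have hf' : DifferentiableOn ℂ (deriv f) (Metric.ball 0 1) := hf.deriv Metric.isOpen_ball
  have hmeas : Measurable fun z => ‖deriv f z‖ₑ ^ 2 := (measurable_deriv f).enorm.pow_const 2
  rw [← setOf_norm_mem_Ico, lintegral_norm_mem_eq_polar measurableSet_Ico (by fun_prop)]
  have hset : Ico (0 : ℝ) 1 ∩ Ioi 0 = Ioo 0 1 := by
    ext x
    simp only [mem_inter_iff, mem_Ico, mem_Ioi, mem_Ioo]
    grind
  rw [hset]
  calc _ = ∫⁻ ρ in Ioo (0 : ℝ) 1, ENNReal.ofReal (2 * Real.pi) *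
        ∑' k, ENNReal.ofReal ((‖taylorCoeff f (k + 1)‖ ^ 2 * (k + 1) ^ 2) *
          (ρ ^ (2 * k + 1) - ρ ^ (2 * k + 3))) := by
        refine setLIntegral_congr_fun measurableSet_Ioo fun ρ hρ => ?_
        have hnorm : ∀ θ, ‖circleMap 0 ρ θ‖ = ρ := fun θ => by
          rw [norm_circleMap_zero, abs_of_pos hρ.1]
        simp_rw [hnorm]
        have hm : Measurable fun θ => ‖deriv f (circleMap 0 ρ θ)‖ₑ ^ 2 :=
          hmeas.comp (continuous_circleMap 0 ρ).measurable
        rw [lintegral_mul_const _ hm, lintegral_circle_sq_enorm_taylorCoeff hf' hρ.1.le hρ.2,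
          mul_left_comm, mul_assoc, ← ENNReal.tsum_mul_right]
        congr 1
        refine tsum_congr fun k => ?_
        have hρ0 : 0 < ρ := hρ.1
        have h1 : 0 ≤ 1 - ρ ^ 2 := by nlinarith [hρ.1, hρ.2]
        rw [← ENNReal.ofReal_mul hρ.1.le, ← ENNReal.ofReal_mul (by positivity), taylorCoeff_deriv]
        congr 1
        rw [norm_mul, mul_pow]
        have : ‖(k : ℂ) + 1‖ = k + 1 := by exact_mod_cast Complex.norm_natCast (k + 1)
        rw [this]
        ring
    _ = ENNReal.ofReal (2 * Real.pi) * ∑' k : ℕ, ∫⁻ ρ in Ioo (0 : ℝ) 1,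
        ENNReal.ofReal ((‖taylorCoeff f (k + 1)‖ ^ 2 * (k + 1) ^ 2) *
          (ρ ^ (2 * k + 1) - ρ ^ (2 * k + 3))) := by
        rw [lintegral_const_mul _ (by fun_prop), lintegral_tsum (fun k => by fun_prop)]
    -- The radial integral is `(k+1)² (1/(2k+2) - 1/(2k+4)) = (k+1) / (2(k+2)) ≤ 1/2`.
    _ ≤ ENNReal.ofReal (2 * Real.pi) * ∑' k : ℕ,
        ENNReal.ofReal (‖taylorCoeff f (k + 1)‖ ^ 2) * ENNReal.ofReal (1 / 2) := by
        gcongr with k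
        rw [setLIntegral_Ioo_ofReal_eq_sub zero_le_one
          (F := fun ρ => (‖taylorCoeff f (k + 1)‖ ^ 2 * (k + 1) ^ 2) *
            (ρ ^ (2 * k + 2) / (2 * k + 2) - ρ ^ (2 * k + 4) / (2 * k + 4)))
          (fun x _ => ?_) (by fun_prop) (fun x hx => ?_), ← ENNReal.ofReal_mul (by positivity)]
        · refine ENNReal.ofReal_le_ofReal ?_
          simp only [one_pow, ne_eq, Nat.add_eq_zero_iff, OfNat.ofNat_ne_zero, and_false,
            not_false_eq_true, zero_pow, zero_div, sub_zero, mul_zero, mul_assoc]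
          gcongr
          rw [div_sub_div _ _ (by positivity) (by positivity), ← mul_div_assoc,
            div_le_div_iff₀ (by positivity) (by positivity)]
          have : (0 : ℝ) ≤ k := k.cast_nonneg
          nlinarith [this, mul_nonneg this this]
        · refine HasDerivAt.const_mul _ (HasDerivAt.sub ?_ ?_)
          · refine ((hasDerivAt_pow (2 * k + 2) x).div_const _).congr_deriv ?_
            push_cast
            field_simp
          · refine ((hasDerivAt_pow (2 * k + 4) x).div_const _).congr_deriv ?_
            push_cast
            field_simp
        · refine mul_nonneg (by positivity) (sub_nonneg.2 ?_)
          exact pow_le_pow_of_le_one hx.1.le hx.2.le (by lia)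
    _ ≤ ENNReal.ofReal (2 * Real.pi) * (1 * ENNReal.ofReal (1 / 2)) := by
        rw [ENNReal.tsum_mul_right]
        gcongr
        exact (ENNReal.tsum_comp_le_tsum_of_injective (add_left_injective 1)
          fun k => ENNReal.ofReal (‖taylorCoeff f k‖ ^ 2)).trans (tsum_sq_taylorCoeff_le_one hf hb)
    _ = ENNReal.ofReal Real.pi := by
        rw [one_mul, ← ENNReal.ofReal_mul (by positivity)]
        congr 1
        ring

/-! ### Area integrals of the two kernels. -/

/-- The area integral of `1 / (1 - |z|²)` over a disk of radius less than one. -/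
theorem lintegral_inv_one_sub_sq_norm {r : ℝ} (h0 : 0 ≤ r) (h1 : r < 1) :
    ∫⁻ z in Metric.ball (0 : ℂ) r, ENNReal.ofReal (1 / (1 - ‖z‖ ^ 2)) =
      ENNReal.ofReal (Real.pi * -Real.log (1 - r ^ 2)) := by
  have hball : {z : ℂ | ‖z‖ ∈ Ico (0 : ℝ) r} = Metric.ball 0 r := by
    ext z
    simp
  rw [← hball, lintegral_norm_mem_eq_polar measurableSet_Ico (by fun_prop)]
  have hset : Ico (0 : ℝ) r ∩ Ioi 0 = Ioo 0 r := by
    ext x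
    simp only [mem_inter_iff, mem_Ico, mem_Ioi, mem_Ioo]
    grind
  have hne : ∀ x ∈ Icc 0 r, 0 < 1 - x ^ 2 := fun x hx => by nlinarith [hx.1, hx.2]
  have h := setLIntegral_Ioo_ofReal_eq_sub h0 (F := fun x => Real.pi * -Real.log (1 - x ^ 2))
    (f := fun x => 2 * Real.pi * (x * (1 / (1 - x ^ 2)))) (fun x hx => ?_) ?_ fun x hx => ?_
  · rw [hset]
    simp only [ne_eq, OfNat.ofNat_ne_zero, not_false_eq_true, zero_pow, sub_zero, Real.log_one,
      neg_zero, mul_zero] at h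
    rw [← h]
    refine setLIntegral_congr_fun measurableSet_Ioo fun ρ hρ => ?_
    simp only [norm_circleMap_zero, abs_of_pos hρ.1, setLIntegral_const, Real.volume_Ioo]
    have := hne ρ ⟨hρ.1.le, hρ.2.le⟩
    rw [← ENNReal.ofReal_mul (by positivity), ← ENNReal.ofReal_mul hρ.1.le]
    congr 1
    ring
  · have hd := ((((hasDerivAt_pow 2 x).const_sub 1).log (hne x hx).ne').neg).const_mul Real.pi
    refine hd.congr_deriv ?_
    have := (hne x hx).ne'
    field_simp
    simp [mul_comm]
  · refine ContinuousOn.mul continuousOn_const (continuousOn_id.mul ?_)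
    exact continuousOn_const.div (by fun_prop) fun x hx => (hne x hx).ne'
  · have := hne x ⟨hx.1.le, hx.2.le⟩
    have := hx.1
    positivity

/-- The area integral over an annulus of the derivative of a disk automorphism. -/
theorem lintegral_annulus_kernel_le {a : ℂ} (ha : ‖a‖ < 1) {r : ℝ} (h0 : 0 ≤ r) (h1 : r < 1) :
    ∫⁻ z in {z : ℂ | ‖z‖ ∈ Ico r 1},
      ENNReal.ofReal (1 - ‖a‖ ^ 2) * ‖(1 - conj a * z)⁻¹‖ₑ ^ 2 ≤
      ENNReal.ofReal (Real.pi * (1 - r ^ 2)) := by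
  have ha2 : 0 < 1 - ‖a‖ ^ 2 := by nlinarith [norm_nonneg a]
  have hmeas : Measurable fun z => ‖(1 - conj a * z)⁻¹‖ₑ ^ 2 := by fun_prop
  have hlt : ∀ z : ℂ, ‖z‖ < 1 → ‖conj a * z‖ < 1 := fun z hz => by
    rw [norm_mul, Complex.norm_conj]
    exact mul_lt_one_of_nonneg_of_lt_one_left (norm_nonneg _) ha hz.le
  rw [lintegral_norm_mem_eq_polar measurableSet_Ico (hmeas.const_mul _)]
  have hsub : Ico r 1 ∩ Ioi 0 ⊆ Ico r 1 := inter_subset_left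
  calc _ ≤ ∫⁻ ρ in Ico r 1 ∩ Ioi 0, ENNReal.ofReal (2 * Real.pi * ρ) := by
        refine setLIntegral_mono' (measurableSet_Ico.inter measurableSet_Ioi) fun ρ hρ => ?_
        have hρ0 : 0 < ρ := hρ.2
        have hρ1 : ρ < 1 := hρ.1.2
        have hc : Measurable fun θ => ‖(1 - conj a * circleMap 0 ρ θ)⁻¹‖ₑ ^ 2 :=
          hmeas.comp (continuous_circleMap 0 ρ).measurable
        rw [lintegral_const_mul _ hc, lintegral_circle_sq_enorm
          (f := fun z => (1 - conj a * z)⁻¹) (a := fun k => conj a ^ k) hρ0.le]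
        -- Dropping `ρ ^ (2k) ≤ 1` leaves a geometric series whose sum cancels the factor `1 -
        -- |a|²`, so the bound does not depend on `a`.
        · have hle : ∑' k, ENNReal.ofReal (‖conj a ^ k‖ ^ 2 * ρ ^ (2 * k)) ≤
              ENNReal.ofReal (1 - ‖a‖ ^ 2)⁻¹ := by
            have hg := hasSum_geometric_of_lt_one (sq_nonneg ‖a‖) (by linarith)
            rw [← hg.tsum_eq, ENNReal.ofReal_tsum_of_nonneg (fun k => by positivity) hg.summable]
            refine ENNReal.tsum_le_tsum fun k => ENNReal.ofReal_le_ofReal ?_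
            rw [norm_pow, Complex.norm_conj, pow_right_comm]
            exact mul_le_of_le_one_right (by positivity) (pow_le_one₀ hρ0.le hρ1.le)
          calc _ ≤ ENNReal.ofReal ρ * (ENNReal.ofReal (1 - ‖a‖ ^ 2) *
                (ENNReal.ofReal (2 * Real.pi) * ENNReal.ofReal (1 - ‖a‖ ^ 2)⁻¹)) := by gcongr
            _ = _ := by
              rw [← ENNReal.ofReal_mul (by positivity), ← ENNReal.ofReal_mul ha2.le,
                ← ENNReal.ofReal_mul hρ0.le]
              congr 1
              field_simp
        · refine (summable_geometric_of_lt_one (norm_nonneg (conj a * ρ)) ?_).congr fun k => ?_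
          · exact hlt _ (by rwa [Complex.norm_real, Real.norm_of_nonneg hρ0.le])
          · rw [norm_mul, mul_pow, norm_pow, Complex.norm_real, Real.norm_of_nonneg hρ0.le]
        · intro z hz
          simpa [mul_pow] using hasSum_geometric_of_norm_lt_one (hlt z (hz.trans_lt hρ1))
        · refine ContinuousOn.inv₀ (by fun_prop) fun z hz h => ?_
          have h' := hlt z (by simp_all)
          rw [← sub_eq_zero.1 h, norm_one] at h'
          exact lt_irrefl _ h'
    _ ≤ ∫⁻ ρ in Ioo r 1, ENNReal.ofReal (2 * Real.pi * ρ) := by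
        rw [setLIntegral_congr (Ioo_ae_eq_Ico (a := r) (b := (1 : ℝ)) (μ := volume))]
        exact lintegral_mono_set hsub
    _ = _ := by
        rw [setLIntegral_Ioo_ofReal_eq_sub h1.le (F := fun x => Real.pi * x ^ 2)
          (fun x _ => ?_) (by fun_prop) (fun x hx => ?_)]
        · congr 1
          ring
        · refine ((hasDerivAt_pow 2 x).const_mul Real.pi).congr_deriv ?_
          simp
          ring
        · have := h0.trans hx.1.le
          positivity

/-! ### The upper bound. -/

theorem derivIntegral_eq (f : ℂ → ℂ) : derivIntegral f =
    ENNReal.ofReal (1 / Real.pi) * ∫⁻ z in Metric.ball (0 : ℂ) 1, ‖deriv f z‖ₑ := by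
  rw [derivIntegral, normalizedArea, Measure.restrict_smul, lintegral_smul_measure, smul_eq_mul]

theorem one_sub_conj_mul_ne_zero {a z : ℂ} (ha : ‖a‖ < 1) (hz : ‖z‖ < 1) :
    1 - conj a * z ≠ 0 := fun h => by
  have h' : ‖conj a * z‖ < 1 := by
    rw [norm_mul, Complex.norm_conj]
    exact mul_lt_one_of_nonneg_of_lt_one_left (norm_nonneg _) ha hz.le
  rw [← sub_eq_zero.1 h, norm_one] at h'
  exact lt_irrefl _ h'

theorem norm_blaschke_factor_le_one {a z : ℂ} (ha : ‖a‖ < 1) (hz : ‖z‖ < 1) :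
    ‖(a - z) / (1 - conj a * z)‖ ≤ 1 := by
  rw [norm_div]
  refine div_le_one_of_le₀ ?_ (norm_nonneg _)
  refine (sq_le_sq₀ (norm_nonneg _) (norm_nonneg _)).1 (sub_nonneg.1 ?_)
  have h : ‖1 - conj a * z‖ ^ 2 - ‖a - z‖ ^ 2 = (1 - ‖a‖ ^ 2) * (1 - ‖z‖ ^ 2) := by
    simp only [Complex.sq_norm, Complex.normSq_apply, Complex.sub_re, Complex.sub_im,
      Complex.mul_re, Complex.mul_im, Complex.conj_re, Complex.conj_im, Complex.one_re,
      Complex.one_im]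
    ring
  rw [h]
  exact mul_nonneg (by nlinarith [norm_nonneg a]) (by nlinarith [norm_nonneg z])

theorem hasDerivAt_blaschke_factor {a z : ℂ} (h : 1 - conj a * z ≠ 0) :
    HasDerivAt (fun z => (a - z) / (1 - conj a * z))
      (-((1 - ‖a‖ ^ 2 : ℝ) : ℂ) * ((1 - conj a * z)⁻¹) ^ 2) z := by
  have h1 : HasDerivAt (fun z => a - z) (-1) z := (hasDerivAt_id z).const_sub a
  have h2 : HasDerivAt (fun z => 1 - conj a * z) (-(conj a)) z := by
    simpa using ((hasDerivAt_id z).const_mul (conj a)).const_sub 1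
  refine (h1.div h2 h).congr_deriv ?_
  have h3 : ((‖a‖ : ℂ)) ^ 2 = conj a * a := by
    rw [Complex.conj_mul']
  push_cast
  rw [h3]
  field_simp
  ring

/-- Cauchy-Schwarz for the Lebesgue integral. -/
theorem lintegral_mul_le_sqrt_mul_sqrt {α : Type*} [MeasurableSpace α] {μ : Measure α}
    {f g : α → ℝ≥0∞} (hf : AEMeasurable f μ) (hg : AEMeasurable g μ) :
    ∫⁻ x, f x * g x ∂μ ≤
      (∫⁻ x, f x ^ 2 ∂μ) ^ (1 / 2 : ℝ) * (∫⁻ x, g x ^ 2 ∂μ) ^ (1 / 2 : ℝ) := by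
  simpa only [ENNReal.rpow_two, Pi.mul_apply] using
    ENNReal.lintegral_mul_le_Lp_mul_Lq μ Real.HolderConjugate.two_two hf hg

/-- The integral of `|f'|` over a smaller disk, for a holomorphic function bounded by one. -/
theorem lintegral_ball_enorm_deriv_le {f : ℂ → ℂ} (hf : DifferentiableOn ℂ f (Metric.ball 0 1))
    (hb : ∀ z : ℂ, ‖z‖ < 1 → ‖f z‖ ≤ 1) {r : ℝ} (h0 : 0 ≤ r) (h1 : r < 1) :
    ∫⁻ z in Metric.ball (0 : ℂ) r, ‖deriv f z‖ₑ ≤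
      ENNReal.ofReal (Real.pi * √(-Real.log (1 - r ^ 2))) := by
  have hlog : 0 ≤ -Real.log (1 - r ^ 2) :=
    neg_nonneg.2 (Real.log_nonpos (by nlinarith) (by nlinarith))
  have hpos : ∀ z ∈ Metric.ball (0 : ℂ) r, 0 < 1 - ‖z‖ ^ 2 := fun z hz => by
    have := mem_ball_zero_iff.1 hz
    nlinarith [norm_nonneg z]
  calc ∫⁻ z in Metric.ball (0 : ℂ) r, ‖deriv f z‖ₑ
      = ∫⁻ z in Metric.ball (0 : ℂ) r, (‖deriv f z‖ₑ * ENNReal.ofReal (√(1 - ‖z‖ ^ 2))) *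
          ENNReal.ofReal (1 / √(1 - ‖z‖ ^ 2)) := by
        refine setLIntegral_congr_fun measurableSet_ball fun z hz => ?_
        have := Real.sqrt_pos.2 (hpos z hz)
        rw [mul_assoc, ← ENNReal.ofReal_mul this.le, mul_one_div_cancel this.ne',
          ENNReal.ofReal_one, mul_one]
    _ ≤ _ := lintegral_mul_le_sqrt_mul_sqrt
        (((measurable_deriv f).enorm.mul (by fun_prop)).aemeasurable) (by fun_prop)
    _ ≤ (ENNReal.ofReal Real.pi) ^ (1 / 2 : ℝ) *
        (ENNReal.ofReal (Real.pi * -Real.log (1 - r ^ 2))) ^ (1 / 2 : ℝ) := by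
        gcongr
        · refine le_trans ?_ (lintegral_sq_deriv_mul_le hf hb)
          refine le_trans (setLIntegral_mono' measurableSet_ball fun z hz => ?_)
            (lintegral_mono_set (Metric.ball_subset_ball h1.le))
          rw [mul_pow, ← ENNReal.ofReal_pow (by positivity), Real.sq_sqrt (hpos z hz).le]
        · rw [← lintegral_inv_one_sub_sq_norm h0 h1]
          refine setLIntegral_mono' measurableSet_ball fun z hz => ?_
          rw [← ENNReal.ofReal_pow (by positivity), div_pow, Real.sq_sqrt (hpos z hz).le, one_pow]
    _ = _ := by
        rw [ENNReal.ofReal_rpow_of_nonneg (by positivity) (by positivity),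
          ENNReal.ofReal_rpow_of_nonneg (by positivity) (by positivity),
          ← ENNReal.ofReal_mul (by positivity), ← Real.sqrt_eq_rpow, ← Real.sqrt_eq_rpow,
          Real.sqrt_mul (by positivity), ← mul_assoc, Real.mul_self_sqrt (by positivity)]

namespace IsFiniteBlaschkeProduct

variable {n : ℕ} {B : ℂ → ℂ}

theorem norm_le_one (hB : IsFiniteBlaschkeProduct n B) {z : ℂ} (hz : ‖z‖ < 1) : ‖B z‖ ≤ 1 := by
  obtain ⟨u, a, hu, ha, h⟩ := hB
  rw [h z (mem_ball_zero_iff.2 hz), norm_mul, hu, one_mul, norm_prod]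
  exact Finset.prod_le_one (fun _ _ => norm_nonneg _) fun k _ =>
    norm_blaschke_factor_le_one (ha k) hz

/-- Product rule: in each term one factor is differentiated and the others have modulus at most one.
-/
theorem exists_hasDerivAt (hB : IsFiniteBlaschkeProduct n B) :
    ∃ a : Fin n → ℂ, (∀ k, ‖a k‖ < 1) ∧ ∀ z : ℂ, ‖z‖ < 1 → ∃ D, HasDerivAt B D z ∧
      ‖D‖ₑ ≤ ∑ k, ENNReal.ofReal (1 - ‖a k‖ ^ 2) * ‖(1 - conj (a k) * z)⁻¹‖ₑ ^ 2 := by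
  obtain ⟨u, a, hu, ha, h⟩ := hB
  refine ⟨a, ha, fun z hz => ?_⟩
  have hd := (HasDerivAt.fun_finsetProd (u := Finset.univ) fun k _ =>
    hasDerivAt_blaschke_factor (one_sub_conj_mul_ne_zero (ha k) hz)).const_mul u
  refine ⟨_, hd.congr_of_eventuallyEq ?_, ?_⟩
  · filter_upwards [Metric.isOpen_ball.mem_nhds (mem_ball_zero_iff.2 hz)] with w hw using h w hw
  · rw [enorm_mul, ← ofReal_norm u, hu, ENNReal.ofReal_one, one_mul]
    refine (enorm_sum_le _ _).trans (Finset.sum_le_sum fun k _ => ?_)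
    have hk : 0 ≤ 1 - ‖a k‖ ^ 2 := by nlinarith [norm_nonneg (a k), ha k]
    rw [smul_eq_mul, enorm_mul, enorm_mul, enorm_neg, enorm_pow, ← ofReal_norm (Complex.ofReal _),
      Complex.norm_real, Real.norm_of_nonneg hk, ← ofReal_norm (Finset.prod _ _), norm_prod]
    refine mul_le_of_le_one_left' (ENNReal.ofReal_le_one.2 ?_)
    exact Finset.prod_le_one (fun _ _ => norm_nonneg _) fun j _ =>
      norm_blaschke_factor_le_one (ha j) hz

theorem differentiableOn (hB : IsFiniteBlaschkeProduct n B) :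
    DifferentiableOn ℂ B (Metric.ball 0 1) := fun z hz => by
  obtain ⟨a, -, h⟩ := hB.exists_hasDerivAt
  obtain ⟨D, hD, -⟩ := h z (mem_ball_zero_iff.1 hz)
  exact hD.differentiableAt.differentiableWithinAt

theorem lintegral_annulus_enorm_deriv_le (hB : IsFiniteBlaschkeProduct n B) {r : ℝ} (h0 : 0 ≤ r)
    (h1 : r < 1) : ∫⁻ z in {z : ℂ | ‖z‖ ∈ Ico r 1}, ‖deriv B z‖ₑ ≤
      ENNReal.ofReal (n * (Real.pi * (1 - r ^ 2))) := by
  obtain ⟨a, ha, h⟩ := hB.exists_hasDerivAt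
  calc _ ≤ ∫⁻ z in {z : ℂ | ‖z‖ ∈ Ico r 1},
        ∑ k, ENNReal.ofReal (1 - ‖a k‖ ^ 2) * ‖(1 - conj (a k) * z)⁻¹‖ₑ ^ 2 := by
        refine setLIntegral_mono' (measurable_norm measurableSet_Ico) fun z hz => ?_
        obtain ⟨D, hD, hle⟩ := h z hz.2
        rwa [hD.deriv]
    _ = ∑ k, ∫⁻ z in {z : ℂ | ‖z‖ ∈ Ico r 1},
        ENNReal.ofReal (1 - ‖a k‖ ^ 2) * ‖(1 - conj (a k) * z)⁻¹‖ₑ ^ 2 :=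
        lintegral_finsetSum _ fun k _ => by fun_prop
    _ ≤ ∑ _k : Fin n, ENNReal.ofReal (Real.pi * (1 - r ^ 2)) :=
        Finset.sum_le_sum fun k _ => lintegral_annulus_kernel_le (ha k) h0 h1
    _ = _ := by
        rw [Finset.sum_const, Finset.card_univ, Fintype.card_fin, nsmul_eq_mul,
          ENNReal.ofReal_mul (Nat.cast_nonneg n), ENNReal.ofReal_natCast]

/-- A finite Blaschke product of degree `n` has `I(B) ≤ 1 + √(log n)`. -/
theorem derivIntegral_le (hn : 1 ≤ n) (hB : IsFiniteBlaschkeProduct n B) :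
    derivIntegral B ≤ ENNReal.ofReal (1 + √(Real.log n)) := by
  have hn' : (1 : ℝ) ≤ n := by exact_mod_cast hn
  have hinv : (n : ℝ)⁻¹ ≤ 1 := inv_le_one_of_one_le₀ hn'
  have hinv0 : 0 < (n : ℝ)⁻¹ := by positivity
  -- With `1 - r² = 1/n` the inner logarithm is `log n` and the `n` annulus terms add up to `π`.
  set r := √(1 - (n : ℝ)⁻¹) with hr
  have hr2 : r ^ 2 = 1 - (n : ℝ)⁻¹ := Real.sq_sqrt (by linarith)
  have h0 : 0 ≤ r := Real.sqrt_nonneg _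
  have h1 : r < 1 := by nlinarith
  have hcover : Metric.ball (0 : ℂ) 1 ⊆ Metric.ball 0 r ∪ {z : ℂ | ‖z‖ ∈ Ico r 1} := fun z hz => by
    rcases lt_or_ge ‖z‖ r with h | h
    · exact Or.inl (mem_ball_zero_iff.2 h)
    · exact Or.inr ⟨h, mem_ball_zero_iff.1 hz⟩
  rw [derivIntegral_eq]
  calc _ ≤ ENNReal.ofReal (1 / Real.pi) * (ENNReal.ofReal (Real.pi * √(-Real.log (1 - r ^ 2))) +
        ENNReal.ofReal (n * (Real.pi * (1 - r ^ 2)))) := by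
        gcongr
        refine (lintegral_mono_set hcover).trans ((lintegral_union_le _ _ _).trans ?_)
        exact add_le_add (lintegral_ball_enorm_deriv_le hB.differentiableOn
          (fun z hz => hB.norm_le_one hz) h0 h1) (hB.lintegral_annulus_enorm_deriv_le h0 h1)
    _ = _ := by
        rw [hr2, sub_sub_cancel, Real.log_inv, neg_neg, ← ENNReal.ofReal_add (by positivity)
          (by positivity), ← ENNReal.ofReal_mul (by positivity)]
        congr 1
        field_simp
        ring

end IsFiniteBlaschkeProduct

/-! ### Lower bounds for the integral of `|f'|` by Taylor coefficients. -/

theorem circleIntegral_zpow_mul_eval (q : Polynomial ℂ) (m : ℕ) {ρ : ℝ} (hρ : 0 < ρ) :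
    ∮ z in C(0, ρ), z ^ (-(m + 1 : ℤ)) * q.eval z = 2 * Real.pi * Complex.I * q.coeff m := by
  have hci : ∀ k : ℤ, CircleIntegrable (fun z : ℂ => z ^ k) 0 ρ := fun k =>
    ContinuousOn.circleIntegrable hρ.le fun z hz => by
      have hz0 : z ≠ 0 := by
        rintro rfl
        simp [hρ.ne] at hz
      exact (continuousAt_zpow₀ z k (Or.inl hz0)).continuousWithinAt
  have hval : ∀ k : ℤ, (∮ z in C(0, ρ), z ^ k) = if k = -1 then 2 * Real.pi * Complex.I else 0 := by
    intro k
    split_ifs with hk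
    · subst hk
      have := circleIntegral.integral_sub_inv_of_mem_ball (c := 0) (w := 0) (R := ρ) (by simpa)
      simpa using this
    · simpa using circleIntegral.integral_sub_zpow_of_ne hk 0 0 ρ
  -- The range is long enough to contain `m` even when `m` exceeds the degree.
  calc _ = ∮ z in C(0, ρ), ∑ k ∈ Finset.range (q.natDegree + 1 + m + 1),
        q.coeff k * z ^ ((k : ℤ) - (m + 1)) := by
        refine circleIntegral.integral_congr hρ.le fun z hz => ?_
        have hz0 : z ≠ 0 := by
          rintro rfl
          simp [hρ.ne] at hz
        rw [q.eval_eq_sum_range' (n := q.natDegree + 1 + m + 1) (by lia), Finset.mul_sum]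
        refine Finset.sum_congr rfl fun k _ => ?_
        rw [sub_eq_add_neg, zpow_add₀ hz0, zpow_natCast]
        ring
    _ = ∑ k ∈ Finset.range (q.natDegree + 1 + m + 1),
        q.coeff k * ∮ z in C(0, ρ), z ^ ((k : ℤ) - (m + 1)) := by
        rw [circleIntegral.integral_fun_sum]
        · refine Finset.sum_congr rfl fun k _ => circleIntegral.integral_const_mul _ _ _ _
        · intro k _
          exact (hci _).const_mul (q.coeff k)
    _ = _ := by
        rw [Finset.sum_eq_single m]
        · rw [hval, if_pos (by ring), mul_comm]
        · intro k _ hk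
          rw [hval, if_neg (by lia), mul_zero]
        · intro h
          simp only [Finset.mem_range] at h
          lia

theorem enorm_circleIntegral_le (F : ℂ → ℂ) {ρ : ℝ} (hρ : 0 < ρ) :
    ‖∮ z in C(0, ρ), F z‖ₑ ≤
      ENNReal.ofReal ρ * ∫⁻ θ in Ioo (-Real.pi) Real.pi, ‖F (circleMap 0 ρ θ)‖ₑ := by
  have hp : Function.Periodic (fun θ => deriv (circleMap 0 ρ) θ • F (circleMap 0 ρ θ))
      (2 * Real.pi) := fun θ => by
    simp only [deriv_circleMap, periodic_circleMap 0 ρ θ]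
  have h := hp.intervalIntegral_add_eq 0 (-Real.pi)
  rw [zero_add, show -Real.pi + 2 * Real.pi = Real.pi by ring] at h
  rw [circleIntegral, h, intervalIntegral.integral_of_le (by linarith [Real.pi_pos]),
    integral_Ioc_eq_integral_Ioo]
  refine (enorm_integral_le_lintegral_enorm _).trans ?_
  rw [← lintegral_const_mul' _ _ ENNReal.ofReal_ne_top]
  refine lintegral_mono fun θ => ?_
  rw [enorm_smul, deriv_circleMap, enorm_mul, ← ofReal_norm (circleMap _ _ _),
    ← ofReal_norm Complex.I, Complex.norm_I, ENNReal.ofReal_one, mul_one, norm_circleMap_zero,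
    abs_of_pos hρ]

/-- A Taylor coefficient bounds the circle mean of the derivative from below. -/
theorem ofReal_coeff_le_lintegral_circle {f h : ℂ → ℂ} {p : Polynomial ℂ} {M d : ℕ} (hd : 0 < d)
    (hdM : d < M) (hh : DifferentiableOn ℂ h (Metric.ball 0 1))
    (hf : ∀ z ∈ Metric.ball (0 : ℂ) 1, f z = p.eval z + z ^ M * h z) {ρ : ℝ} (h0 : 0 < ρ)
    (h1 : ρ < 1) :
    ENNReal.ofReal (2 * Real.pi * (d * ‖p.coeff d‖) * ρ ^ d) ≤
      ENNReal.ofReal ρ *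
        ∫⁻ θ in Ioo (-Real.pi) Real.pi, ‖deriv f (circleMap 0 ρ θ)‖ₑ := by
  -- With `d = m + 1` and `M ≥ m + 2`, the remainder contributes a multiple of `z ^ (m + 1)` to
  -- `f'`. Multiplying by `z ^ (-(m + 1))` leaves it holomorphic, so its circle integral vanishes.
  obtain ⟨m, rfl⟩ : ∃ m, d = m + 1 := ⟨d - 1, by lia⟩
  obtain ⟨j, rfl⟩ : ∃ j, M = m + 1 + j + 1 := ⟨M - (m + 2), by lia⟩
  have hball : Metric.closedBall (0 : ℂ) ρ ⊆ Metric.ball 0 1 := Metric.closedBall_subset_ball h1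
  have hderiv : ∀ z ∈ Metric.ball (0 : ℂ) 1, deriv f z = p.derivative.eval z +
      z ^ (m + 1) * (z ^ j * (((m + 1 + j + 1 : ℕ) : ℂ) * h z + z * deriv h z)) := by
    intro z hz
    have hhz := (hh.differentiableAt (Metric.isOpen_ball.mem_nhds hz)).hasDerivAt
    have hd := (p.hasDerivAt z).add ((hasDerivAt_pow (m + 1 + j + 1) z).mul hhz)
    rw [(hd.congr_of_eventuallyEq (f₁ := f) ?_).deriv]
    · rw [Nat.add_sub_cancel]
      ring
    · filter_upwards [Metric.isOpen_ball.mem_nhds hz] with w hw using hf w hw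
  have hrem : DifferentiableOn ℂ
      (fun z => z ^ j * (((m + 1 + j + 1 : ℕ) : ℂ) * h z + z * deriv h z)) (Metric.ball 0 1) := by
    have := hh.deriv Metric.isOpen_ball
    fun_prop
  have hzero : ∮ z in C(0, ρ),
      z ^ j * (((m + 1 + j + 1 : ℕ) : ℂ) * h z + z * deriv h z) = 0 := by
    refine DiffContOnCl.circleIntegral_eq_zero h0.le ?_
    exact (hrem.mono (by rwa [closure_ball _ h0.ne'])).diffContOnCl
  have hsphere : ∀ z ∈ Metric.sphere (0 : ℂ) ρ, z ≠ 0 := by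
    rintro _ hz rfl
    simp [h0.ne] at hz
  have hzpow : ContinuousOn (fun z : ℂ => z ^ (-(m + 1 : ℤ))) (Metric.sphere 0 ρ) := fun z hz =>
    (continuousAt_zpow₀ z _ (Or.inl (hsphere z hz))).continuousWithinAt
  have hint : ∮ z in C(0, ρ), z ^ (-(m + 1 : ℤ)) * deriv f z =
      2 * Real.pi * Complex.I * (p.derivative).coeff m := by
    have hadd := circleIntegral.integral_add
      (f := fun z => z ^ (-(m + 1 : ℤ)) * p.derivative.eval z)
      ((hzpow.mul p.derivative.continuous.continuousOn).circleIntegrable h0.le)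
      ((hrem.continuousOn.mono (Metric.sphere_subset_closedBall.trans hball)).circleIntegrable
        h0.le)
    rw [hzero, add_zero, circleIntegral_zpow_mul_eval _ m h0] at hadd
    rw [← hadd]
    refine circleIntegral.integral_congr h0.le fun z hz => ?_
    rw [hderiv z (hball (Metric.sphere_subset_closedBall hz)), mul_add, ← mul_assoc]
    congr 1
    rw [← zpow_natCast z (m + 1), ← zpow_add₀ (hsphere z hz)]
    simp
  have hle := enorm_circleIntegral_le (fun z => z ^ (-(m + 1 : ℤ)) * deriv f z) h0
  have hpow : ∀ θ, ‖(circleMap 0 ρ θ) ^ (-(m + 1 : ℤ)) * deriv f (circleMap 0 ρ θ)‖ₑ =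
      ENNReal.ofReal (ρ ^ (m + 1))⁻¹ * ‖deriv f (circleMap 0 ρ θ)‖ₑ := fun θ => by
    rw [enorm_mul, ← ofReal_norm (_ ^ _), norm_zpow, norm_circleMap_zero, abs_of_pos h0, zpow_neg]
    norm_cast
  simp_rw [hpow] at hle
  rw [hint, lintegral_const_mul' _ _ ENNReal.ofReal_ne_top, mul_left_comm] at hle
  have hpos : 0 < ρ ^ (m + 1) := by positivity
  calc _ = ENNReal.ofReal (ρ ^ (m + 1)) *
        ‖2 * Real.pi * Complex.I * (p.derivative).coeff m‖ₑ := by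
        rw [Polynomial.coeff_derivative, ← ofReal_norm, ← ENNReal.ofReal_mul hpos.le]
        congr 1
        have : ‖(m : ℂ) + 1‖ = m + 1 := by exact_mod_cast Complex.norm_natCast (m + 1)
        simp only [norm_mul, this, Complex.norm_I, Complex.norm_real, Complex.norm_ofNat,
          Real.norm_of_nonneg Real.pi_pos.le]
        push_cast
        ring
    _ ≤ ENNReal.ofReal (ρ ^ (m + 1)) * (ENNReal.ofReal (ρ ^ (m + 1))⁻¹ * (ENNReal.ofReal ρ *
        ∫⁻ θ in Ioo (-Real.pi) Real.pi, ‖deriv f (circleMap 0 ρ θ)‖ₑ)) := by gcongr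
    _ = _ := by
        rw [← mul_assoc, ← ENNReal.ofReal_mul hpos.le, mul_inv_cancel₀ hpos.ne',
          ENNReal.ofReal_one, one_mul]

/-- The ring has width `3 / (8d)`, and `ρ ^ d ≥ 1/2` on it by Bernoulli, so the factor `d` cancels.
Its outer radius is the inner radius for `4 * d`, which makes the rings for successive powers of
four disjoint. -/
theorem ofReal_coeff_le_lintegral_annulus {f h : ℂ → ℂ} {p : Polynomial ℂ} {M d : ℕ} (hd : 0 < d)
    (hdM : d < M) (hh : DifferentiableOn ℂ h (Metric.ball 0 1))
    (hf : ∀ z ∈ Metric.ball (0 : ℂ) 1, f z = p.eval z + z ^ M * h z) :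
    ENNReal.ofReal (Real.pi * (3 / 8 * ‖p.coeff d‖)) ≤
      ∫⁻ z in {z : ℂ | ‖z‖ ∈ Ioo (1 - 1 / (2 * d : ℝ)) (1 - 1 / (2 * (4 * d) : ℝ))},
        ‖deriv f z‖ₑ := by
  have hd1 : (1 : ℝ) ≤ d := by exact_mod_cast hd
  have hlow : (1 : ℝ) / 2 ≤ 1 - 1 / (2 * d) := by
    rw [le_sub_comm, div_le_iff₀ (by positivity)]
    linarith
  have hup : 1 - 1 / (2 * (4 * d) : ℝ) < 1 := sub_lt_self _ (by positivity)
  rw [lintegral_norm_mem_eq_polar measurableSet_Ioo (measurable_deriv f).enorm,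
    inter_eq_left.2 fun ρ hρ => mem_Ioi.2 (by linarith [hρ.1])]
  calc _ = ∫⁻ _ in Ioo (1 - 1 / (2 * d : ℝ)) (1 - 1 / (2 * (4 * d) : ℝ)),
        ENNReal.ofReal (2 * Real.pi * (d * ‖p.coeff d‖) * (1 / 2)) := by
        rw [setLIntegral_const, Real.volume_Ioo, ← ENNReal.ofReal_mul (by positivity)]
        congr 1
        field_simp
        ring
    _ ≤ _ := by
        refine setLIntegral_mono' measurableSet_Ioo fun ρ hρ => ?_
        refine le_trans (ENNReal.ofReal_le_ofReal ?_)
          (ofReal_coeff_le_lintegral_circle hd hdM hh hf (by linarith [hρ.1]) (hρ.2.trans hup))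
        gcongr
        calc (1 : ℝ) / 2 = 1 + d * (-(1 / (2 * d))) := by
              field_simp
              ring
          _ ≤ (1 + -(1 / (2 * d))) ^ d := one_add_mul_le_pow (by linarith) d
          _ ≤ ρ ^ d := pow_le_pow_left₀ (by linarith) (by linarith [hρ.1]) d

theorem ofReal_coeff_le_derivIntegral {f h : ℂ → ℂ} {p : Polynomial ℂ} {M d : ℕ} (hd : 0 < d)
    (hdM : d < M) (hh : DifferentiableOn ℂ h (Metric.ball 0 1))
    (hf : ∀ z ∈ Metric.ball (0 : ℂ) 1, f z = p.eval z + z ^ M * h z) :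
    ENNReal.ofReal (3 / 8 * ‖p.coeff d‖) ≤ derivIntegral f := by
  have hd1 : (1 : ℝ) ≤ d := by exact_mod_cast hd
  have hup : 1 - 1 / (2 * (4 * d) : ℝ) < 1 := sub_lt_self _ (by positivity)
  rw [derivIntegral_eq]
  calc _ = ENNReal.ofReal (1 / Real.pi) * ENNReal.ofReal (Real.pi * (3 / 8 * ‖p.coeff d‖)) := by
        rw [← ENNReal.ofReal_mul (by positivity)]
        congr 1
        field_simp
    _ ≤ _ := by
        gcongr
        refine (ofReal_coeff_le_lintegral_annulus hd hdM hh hf).trans (lintegral_mono_set ?_)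
        exact fun z hz => mem_ball_zero_iff.2 (hz.2.trans hup)

/-- The Taylor coefficients at the powers of four bound the integral of `|f'|` from below. -/
theorem ofReal_sum_coeff_le_derivIntegral {f h : ℂ → ℂ} {p : Polynomial ℂ} {M L : ℕ}
    (hLM : ∀ j < L, 4 ^ j < M) (hh : DifferentiableOn ℂ h (Metric.ball 0 1))
    (hf : ∀ z ∈ Metric.ball (0 : ℂ) 1, f z = p.eval z + z ^ M * h z) :
    ENNReal.ofReal (3 / 8 * ∑ j ∈ Finset.range L, ‖p.coeff (4 ^ j)‖) ≤ derivIntegral f := by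
  let u : ℕ → ℝ := fun j => 1 - 1 / (2 * 4 ^ j)
  have hu : Monotone u := fun i j hij => by
    simp only [u]
    gcongr
    norm_num
  let A : ℕ → Set ℂ := fun j => {z : ℂ | ‖z‖ ∈ Ioo (u j) (u (j + 1))}
  have hA : ∀ j, MeasurableSet (A j) := fun j => measurable_norm measurableSet_Ioo
  have hdisj : Pairwise (Function.onFun Disjoint A) := fun i j hij =>
    (hu.pairwise_disjoint_on_Ioo_succ hij).preimage _
  have hsub : ⋃ j ∈ Finset.range L, A j ⊆ Metric.ball 0 1 := iUnion₂_subset fun j _ z hz =>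
    mem_ball_zero_iff.2 (hz.2.trans (sub_lt_self _ (by positivity)))
  rw [derivIntegral_eq]
  calc _ = ENNReal.ofReal (1 / Real.pi) * ∑ j ∈ Finset.range L,
        ENNReal.ofReal (Real.pi * (3 / 8 * ‖p.coeff (4 ^ j)‖)) := by
        rw [← ENNReal.ofReal_sum_of_nonneg fun _ _ => by positivity,
          ← ENNReal.ofReal_mul (by positivity), ← Finset.mul_sum, ← Finset.mul_sum]
        congr 1
        field
    _ ≤ ENNReal.ofReal (1 / Real.pi) * ∑ j ∈ Finset.range L, ∫⁻ z in A j, ‖deriv f z‖ₑ := by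
        gcongr with j hj
        have := ofReal_coeff_le_lintegral_annulus (d := 4 ^ j) (by positivity)
          (hLM j (Finset.mem_range.1 hj)) hh hf
        simpa only [A, u, pow_succ', Nat.cast_pow, Nat.cast_ofNat] using this
    _ = ENNReal.ofReal (1 / Real.pi) * ∫⁻ z in ⋃ j ∈ Finset.range L, A j, ‖deriv f z‖ₑ := by
        rw [lintegral_biUnion_finset (fun i _ j _ hij => hdisj hij) fun j _ => hA j]
    _ ≤ _ := by
        gcongr

/-! ### Bounded polynomials with large lacunary coefficients. -/

open Polynomial in
/-- The value on the unit circle of a reflected real polynomial. -/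
theorem aeval_reflect_of_norm_eq_one {p : ℝ[X]} {N : ℕ} (hp : p.natDegree ≤ N) {z : ℂ}
    (hz : ‖z‖ = 1) : aeval z (p.reflect N) = z ^ N * conj (aeval z p) := by
  have hzz : z * conj z = 1 := by rw [Complex.mul_conj', hz]; simp
  let _ : Invertible (conj z) := ⟨z, hzz, by rw [mul_comm, hzz]⟩
  have h := eval₂_reflect_mul_pow (algebraMap ℝ ℂ) (conj z) N p hp
  change aeval z (p.reflect N) * conj z ^ N = aeval (conj z) p at h
  rw [aeval_conj] at h
  rw [← h, mul_left_comm, ← mul_pow, hzz, one_pow, mul_one]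

open Polynomial in
/-- Pairs of real polynomials obtained from `(0, 1)` by lacunary rotations. -/
noncomputable def lacunaryPair (c s : ℝ) : ℕ → ℝ[X] × ℝ[X]
  | 0 => (0, 1)
  | k + 1 =>
    (C c * (lacunaryPair c s k).1 + C s * (lacunaryPair c s k).2.reflect (4 ^ k),
      C c * (lacunaryPair c s k).2 - C s * (lacunaryPair c s k).1.reflect (4 ^ k))

namespace lacunaryPair

open Polynomial

variable (c s : ℝ)

/-- Reflection at `4 ^ k` gives degree at most `4 ^ k`, a quarter of `4 ^ (k + 1)`. Hence the
reflected frequencies lie in the top quarter of `[0, 4 ^ k]`, and the old ones in the bottom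
quarter. -/
theorem natDegree_le (k : ℕ) : 4 * (lacunaryPair c s k).1.natDegree ≤ 4 ^ k ∧
    4 * (lacunaryPair c s k).2.natDegree ≤ 4 ^ k := by
  induction k with
  | zero => simp [lacunaryPair]
  | succ k ih =>
    have h1 := natDegree_reflect_le (N := 4 ^ k) (p := (lacunaryPair c s k).1)
    have h2 := natDegree_reflect_le (N := 4 ^ k) (p := (lacunaryPair c s k).2)
    have h3 := natDegree_add_le (C c * (lacunaryPair c s k).1)
      (C s * (lacunaryPair c s k).2.reflect (4 ^ k))
    have h4 := natDegree_sub_le (C c * (lacunaryPair c s k).2)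
      (C s * (lacunaryPair c s k).1.reflect (4 ^ k))
    have h5 := natDegree_C_mul_le c (lacunaryPair c s k).1
    have h6 := natDegree_C_mul_le c (lacunaryPair c s k).2
    have h7 := natDegree_C_mul_le s ((lacunaryPair c s k).1.reflect (4 ^ k))
    have h8 := natDegree_C_mul_le s ((lacunaryPair c s k).2.reflect (4 ^ k))
    simp only [lacunaryPair, pow_succ]
    lia

/-- On the circle the recursion reads `(P, S) ↦ (c P + s w S̄, c S - s w P̄)` with `w = z ^ 4 ^ k`,
`|w| = 1`; the cross terms in the squared moduli cancel. -/
theorem sq_norm_add_sq_norm (hcs : c ^ 2 + s ^ 2 = 1) (k : ℕ) {z : ℂ} (hz : ‖z‖ = 1) :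
    ‖aeval z (lacunaryPair c s k).1‖ ^ 2 + ‖aeval z (lacunaryPair c s k).2‖ ^ 2 = 1 := by
  induction k with
  | zero => simp [lacunaryPair]
  | succ k ih =>
    have hdeg := natDegree_le c s k
    have hw : ‖z ^ 4 ^ k‖ ^ 2 = 1 := by rw [norm_pow, hz, one_pow, one_pow]
    simp only [lacunaryPair, map_add, map_sub, map_mul, aeval_C, Complex.coe_algebraMap]
    rw [aeval_reflect_of_norm_eq_one (by lia) hz, aeval_reflect_of_norm_eq_one (by lia) hz]
    generalize aeval z (lacunaryPair c s k).1 = P at *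
    generalize aeval z (lacunaryPair c s k).2 = S at *
    generalize z ^ 4 ^ k = w at *
    simp only [Complex.sq_norm, Complex.normSq_apply, Complex.add_re, Complex.add_im,
      Complex.sub_re, Complex.sub_im, Complex.mul_re, Complex.mul_im, Complex.conj_re,
      Complex.conj_im, Complex.ofReal_re, Complex.ofReal_im] at *
    linear_combination (c ^ 2 + s ^ 2) * ih + hcs +
      s ^ 2 * (P.re * P.re + P.im * P.im + S.re * S.re + S.im * S.im) * hw

theorem coeff_snd_zero (k : ℕ) : (lacunaryPair c s k).2.coeff 0 = c ^ k := by
  induction k with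
  | zero => simp [lacunaryPair]
  | succ k ih =>
    have hdeg := natDegree_le c s k
    have hpos : 0 < 4 ^ k := by positivity
    have h0 : (lacunaryPair c s k).1.coeff (4 ^ k) = 0 := coeff_eq_zero_of_natDegree_lt (by lia)
    simp [lacunaryPair, coeff_reflect, ih, h0, pow_succ', revAt_le]

/-- The coefficient at `4 ^ k` is born as `s` times the constant term `c ^ k` of the second
polynomial. Each later step only multiplies it by `c`, since the reflected part misses that
frequency. -/
theorem coeff_fst {k j : ℕ} (hj : j < k) :
    (lacunaryPair c s k).1.coeff (4 ^ j) = s * c ^ (k - 1) := by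
  induction k with
  | zero => simp at hj
  | succ k ih =>
    have hdeg := natDegree_le c s k
    have hpos : 0 < 4 ^ k := by positivity
    rcases (Nat.lt_succ_iff.1 hj).eq_or_lt with rfl | hlt
    · have h0 : (lacunaryPair c s j).1.coeff (4 ^ j) = 0 := coeff_eq_zero_of_natDegree_lt (by lia)
      simp [lacunaryPair, coeff_reflect, h0, coeff_snd_zero, revAt_le]
    · have hle : 4 * 4 ^ j ≤ 4 ^ k := by
        rw [← pow_succ']
        exact Nat.pow_le_pow_right (by norm_num) hlt
      have h0 : (lacunaryPair c s k).2.coeff (4 ^ k - 4 ^ j) = 0 :=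
        coeff_eq_zero_of_natDegree_lt (by lia)
      obtain ⟨i, rfl⟩ : ∃ i, k = i + 1 := ⟨k - 1, by lia⟩
      simp only [lacunaryPair, coeff_add, coeff_C_mul, coeff_reflect] at ih h0 ⊢
      rw [revAt_le (show 4 ^ j ≤ 4 ^ (i + 1) by lia), ih hlt]
      simp only [coeff_sub, coeff_C_mul, coeff_reflect] at h0 ⊢
      rw [h0]
      simp only [Nat.add_sub_cancel, pow_succ]
      ring

end lacunaryPair

/-! ### A Blaschke product with a prescribed initial Taylor polynomial. -/

theorem exists_fin_prod_eq {n : ℕ} (t : Multiset ℂ) (ht : t.card = n) :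
    ∃ a : Fin n → ℂ, (∀ k, a k ∈ t) ∧ ∀ F : ℂ → ℂ, (t.map F).prod = ∏ k, F (a k) := by
  subst ht
  induction t using Quotient.inductionOn with
  | _ l => exact ⟨l.get, fun k => l.get_mem k, fun F => (Fin.prod_univ_fun_getElem l F).symm⟩

open Polynomial in
/-- A real polynomial bounded by one half on the unit circle agrees to high order with a finite
Blaschke product. -/
theorem exists_isFiniteBlaschkeProduct_of_polynomial {p : ℝ[X]} {n : ℕ} (hn : 2 * p.natDegree < n)
    (hp : ∀ z : ℂ, ‖z‖ = 1 → ‖aeval z p‖ ≤ 1 / 2) :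
    ∃ B h : ℂ → ℂ, IsFiniteBlaschkeProduct n B ∧ DifferentiableOn ℂ h (Metric.ball 0 1) ∧
      ∀ z ∈ Metric.ball (0 : ℂ) 1,
        B z = (p.map (algebraMap ℝ ℂ)).eval z + z ^ (n - p.natDegree) * h z := by
  -- The reflection has the same modulus as `p` on the circle; the maximum principle carries the
  -- bound inside.
  have hq : ∀ z : ℂ, ‖z‖ ≤ 1 → ‖aeval z (p.reflect n)‖ ≤ 1 / 2 := by
    intro z hz
    refine Complex.norm_le_of_forall_mem_frontier_norm_le (U := Metric.ball 0 1)
      Metric.isBounded_ball (f := fun z => aeval z (p.reflect n))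
      (Differentiable.diffContOnCl (Polynomial.differentiable_aeval _)) (fun w hw => ?_) ?_
    · rw [frontier_ball _ one_ne_zero, mem_sphere_zero_iff_norm] at hw
      rw [aeval_reflect_of_norm_eq_one (by lia) hw, norm_mul, norm_pow, hw, one_pow, one_mul,
        Complex.norm_conj]
      exact hp w hw
    · rwa [closure_ball _ one_ne_zero, mem_closedBall_zero_iff]
  have hinv : ∀ z : ℂ, z ≠ 0 → aeval z⁻¹ (p.reflect n) * z ^ n = aeval z p := fun z hz => by
    let _ := invertibleOfNonzero hz
    have := eval₂_reflect_mul_pow (algebraMap ℝ ℂ) z n p (by lia)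
    rwa [invOf_eq_inv] at this
  let P : ℂ[X] := X ^ n + p.map (algebraMap ℝ ℂ)
  have hPeval : ∀ z, P.eval z = z ^ n + aeval z p := fun z => by
    simp [P, aeval_def, eval_map]
  have hdeg : (p.map (algebraMap ℝ ℂ)).degree < n := by
    refine degree_le_natDegree.trans_lt ?_
    rw [natDegree_map]
    exact_mod_cast (by lia : p.natDegree < n)
  have hmonic : P.Monic := monic_X_pow_add hdeg
  have hcard : P.roots.card = n := by
    rw [← (IsAlgClosed.splits P).natDegree_eq_card_roots]
    rw [natDegree_add_eq_left_of_degree_lt (by rwa [degree_X_pow]), natDegree_X_pow]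
  -- For `|w| ≥ 1`, `P(w) = w ^ n (1 + p*(1/w))` with `|p*(1/w)| ≤ 1/2`, which is not zero.
  have hroots : ∀ w ∈ P.roots, ‖w‖ < 1 := fun w hw => by
    by_contra! hw1
    have hroot : P.eval w = 0 := isRoot_of_mem_roots hw
    have hw0 : w ≠ 0 := norm_pos_iff.1 (by linarith)
    rw [hPeval, ← hinv w hw0] at hroot
    have hsmall := hq w⁻¹ (by rw [norm_inv]; exact inv_le_one_of_one_le₀ hw1)
    have hfac : (1 + aeval w⁻¹ (p.reflect n)) * w ^ n = 0 := by rw [← hroot]; ring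
    rcases mul_eq_zero.1 hfac with h | h
    · rw [← neg_eq_of_add_eq_zero_right h, norm_neg, norm_one] at hsmall
      norm_num at hsmall
    · exact hw0 (pow_eq_zero_iff (by lia) |>.1 h)
  obtain ⟨a, ha, hprod⟩ := exists_fin_prod_eq P.roots hcard
  have hPprod : ∀ z, P.eval z = ∏ k, (z - a k) := fun z => by
    conv_lhs => rw [(IsAlgClosed.splits P).eq_prod_roots, hmonic.leadingCoeff]
    rw [C_1, one_mul, eval_multiset_prod, Multiset.map_map, ← hprod]
    simp
  have hQprod : ∀ z, 1 + aeval z (p.reflect n) = ∏ k, (1 - conj (a k) * z) := fun z => by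
    rcases eq_or_ne z 0 with rfl | hz
    · have h0 : p.coeff n = 0 := coeff_eq_zero_of_natDegree_lt (by lia)
      simp [← coeff_zero_eq_aeval_zero', coeff_reflect, revAt_le, h0]
    · have hw : (conj z)⁻¹ ≠ 0 := by simpa using hz
      have h := congrArg (starRingEnd ℂ) (hPprod (conj z)⁻¹)
      rw [hPeval, ← hinv _ hw, inv_inv, aeval_conj] at h
      simp only [map_add, map_mul, map_pow, map_prod, map_sub, map_inv₀, Complex.conj_conj] at h
      calc 1 + aeval z (p.reflect n)
          = z ^ n * (z⁻¹ ^ n + aeval z (p.reflect n) * z⁻¹ ^ n) := by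
            rw [inv_pow]
            field_simp
        _ = ∏ k, z * (z⁻¹ - conj (a k)) := by
            rw [h, Finset.prod_mul_distrib, Finset.prod_const, Finset.card_univ, Fintype.card_fin]
        _ = _ := Finset.prod_congr rfl fun k _ => by
            rw [mul_sub, mul_inv_cancel₀ hz, mul_comm]
  have hQne : ∀ z : ℂ, ‖z‖ ≤ 1 → 1 + aeval z (p.reflect n) ≠ 0 := fun z hz h => by
    have hsmall := hq z hz
    rw [← neg_eq_of_add_eq_zero_right h, norm_neg, norm_one] at hsmall
    norm_num at hsmall
  have hsplit : p.reflect n = X ^ (n - p.natDegree) * p.reflect p.natDegree := by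
    have h := reflect_mul (1 : ℝ[X]) p (F := n - p.natDegree) (by simp) le_rfl
    rwa [one_mul, reflect_one, Nat.sub_add_cancel (by lia)] at h
  -- Here `B - p = (z ^ n - p p*) / (1 + p*)`; both `z ^ n` and `p*` are divisible by `z ^ (n - deg
  -- p)`, and `h` is the cofactor. The sign `(-1) ^ n` turns `z - a k` into `a k - z`.
  refine ⟨fun z => P.eval z / (1 + aeval z (p.reflect n)),
    fun z => (z ^ p.natDegree - aeval z p * aeval z (p.reflect p.natDegree)) /
      (1 + aeval z (p.reflect n)), ⟨(-1) ^ n, a, by simp, fun k => hroots _ (ha k), ?_⟩, ?_, ?_⟩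
  · intro z _
    simp only
    rw [hPprod, hQprod, Finset.prod_div_distrib, ← mul_div_assoc]
    congr 1
    have hneg : ∀ k, z - a k = -1 * (a k - z) := fun k => by ring
    simp_rw [hneg]
    rw [Finset.prod_mul_distrib, Finset.prod_const, Finset.card_univ, Fintype.card_fin]
  · have h1 := Polynomial.differentiable_aeval (𝕜 := ℂ) p
    have h2 := Polynomial.differentiable_aeval (𝕜 := ℂ) (p.reflect p.natDegree)
    have h3 := Polynomial.differentiable_aeval (𝕜 := ℂ) (p.reflect n)
    refine DifferentiableOn.div (by fun_prop) (by fun_prop) fun z hz => hQne z ?_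
    exact (mem_ball_zero_iff.1 hz).le
  · intro z hz
    have hne := hQne z (mem_ball_zero_iff.1 hz).le
    have hpz : (p.map (algebraMap ℝ ℂ)).eval z = aeval z p := by rw [eval_map, aeval_def]
    have hqz : aeval z (p.reflect n) =
        z ^ (n - p.natDegree) * aeval z (p.reflect p.natDegree) := by
      rw [hsplit]
      simp
    have hzn : z ^ n = z ^ (n - p.natDegree) * z ^ p.natDegree := by
      rw [← pow_add, Nat.sub_add_cancel (by lia)]
    simp only [hPeval]
    rw [hpz, hzn, ← mul_div_assoc, div_eq_iff hne, add_mul, div_mul_cancel₀ _ hne, hqz]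
    ring

/-! ### Choice of parameters and conclusion. -/

theorem isFiniteBlaschkeProduct_pow (n : ℕ) : IsFiniteBlaschkeProduct n fun z => z ^ n := by
  refine ⟨(-1) ^ n, fun _ => 0, by simp, by simp, fun z _ => ?_⟩
  simp only [zero_sub, map_zero, zero_mul, sub_zero, div_one, Finset.prod_const, Finset.card_univ,
    Fintype.card_fin]
  rw [← mul_pow, neg_one_mul, neg_neg]

theorem le_derivIntegral_pow {n : ℕ} (hn : 1 ≤ n) :
    ENNReal.ofReal (3 / 8) ≤ derivIntegral fun z => z ^ n := by
  have h := ofReal_coeff_le_derivIntegral (f := fun z => z ^ n) (h := 0) (p := Polynomial.X ^ n)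
    (M := n + 1) hn n.lt_succ_self (differentiableOn_const 0) (by simp)
  simpa using h

/-- The elementary inequality giving the size of the lacunary coefficients. -/
theorem sqrt_succ_le_mul_inv_sqrt {L : ℕ} (hL : 1 ≤ L) :
    √(L + 1) / 4 ≤ L * ((√(L + 1))⁻¹ * √(L / (L + 1)) ^ (L - 1)) := by
  have hL1 : (1 : ℝ) ≤ L := by exact_mod_cast hL
  have hs : 0 < √((L : ℝ) + 1) := Real.sqrt_pos.2 (by linarith)
  have hsq : √((L : ℝ) + 1) ^ 2 = L + 1 := Real.sq_sqrt (by linarith)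
  have hratio : (L : ℝ) / (L + 1) ≤ 1 := div_le_one_of_le₀ (by linarith) (by linarith)
  -- `(L / (L + 1)) ^ L ≥ 1 / e > 1 / 4`; take square roots.
  have hpow : (1 : ℝ) / 2 ≤ √(L / (L + 1)) ^ (L - 1) := by
    have h1 : √((L : ℝ) / (L + 1)) ^ L ≤ √(L / (L + 1)) ^ (L - 1) :=
      pow_le_pow_of_le_one (Real.sqrt_nonneg _) (Real.sqrt_le_one.2 hratio) (Nat.sub_le _ _)
    refine le_trans ?_ h1
    refine (sq_le_sq₀ (by norm_num) (by positivity)).1 ?_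
    rw [← pow_mul, mul_comm, pow_mul, Real.sq_sqrt (by positivity)]
    have h2 : ((L : ℝ) / (L + 1)) ^ L * (1 + (L : ℝ)⁻¹) ^ L = 1 := by
      rw [← mul_pow]
      have : (L : ℝ) / (L + 1) * (1 + (L : ℝ)⁻¹) = 1 := by field_simp
      rw [this, one_pow]
    have h3 : (1 + (L : ℝ)⁻¹) ^ L ≤ Real.exp 1 := by
      calc (1 + (L : ℝ)⁻¹) ^ L ≤ Real.exp (L : ℝ)⁻¹ ^ L := by
            gcongr
            linarith [Real.add_one_le_exp (L : ℝ)⁻¹]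
        _ = Real.exp 1 := by
            rw [← Real.exp_nat_mul, mul_inv_cancel₀ (by positivity)]
    have h4 := Real.exp_one_lt_d9
    have h5 : 0 < ((L : ℝ) / (L + 1)) ^ L := by positivity
    nlinarith
  calc √((L : ℝ) + 1) / 4 ≤ L * ((√(L + 1))⁻¹ * (1 / 2)) := by
        rw [← sub_nonneg]
        have : L * ((√((L : ℝ) + 1))⁻¹ * (1 / 2)) - √(L + 1) / 4 =
            (2 * L - √(L + 1) ^ 2) / (4 * √(L + 1)) := by
          field_simp
          ring
        rw [this, hsq]
        exact div_nonneg (by linarith) (by positivity)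
    _ ≤ _ := by gcongr

open Polynomial in
/-- Existence of a finite Blaschke product of degree `n` with large `I(B)`. -/
theorem exists_isFiniteBlaschkeProduct_le_derivIntegral {n : ℕ} (hn : 4 ≤ n) :
    ∃ B, IsFiniteBlaschkeProduct n B ∧
      ENNReal.ofReal (3 / 64 * √(Nat.log 4 n + 1)) ≤ derivIntegral B := by
  set L := Nat.log 4 n with hLdef
  have hL : 1 ≤ L := Nat.log_pos (by norm_num) hn
  have hLn : 4 ^ L ≤ n := Nat.pow_log_le_self 4 (by lia)
  have hL1 : (1 : ℝ) ≤ L := by exact_mod_cast hL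
  -- With `s² = 1 / (L + 1)` the damping `c ^ (L - 1)` stays above `1/2`, so the `L` coefficients
  -- sum to order `√L`. The constant is `3/64 = 3/8 * 1/2 * 1/4`.
  let s : ℝ := (√(L + 1))⁻¹
  let c : ℝ := √(L / (L + 1))
  have hcs : c ^ 2 + s ^ 2 = 1 := by
    simp only [c, s]
    rw [inv_pow, Real.sq_sqrt (by positivity), Real.sq_sqrt (by positivity)]
    field_simp
  let p : ℝ[X] := C (1 / 2) * (lacunaryPair c s L).1
  have hdeg : 4 * p.natDegree ≤ 4 ^ L := by
    have h1 := natDegree_C_mul_le (1 / 2) (lacunaryPair c s L).1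
    have h2 := (lacunaryPair.natDegree_le c s L).1
    simp only [p]
    lia
  have hp : ∀ z : ℂ, ‖z‖ = 1 → ‖aeval z p‖ ≤ 1 / 2 := fun z hz => by
    have h := lacunaryPair.sq_norm_add_sq_norm c s hcs L hz
    have h1 : ‖aeval z (lacunaryPair c s L).1‖ ≤ 1 := by
      nlinarith [norm_nonneg (aeval z (lacunaryPair c s L).1),
        sq_nonneg ‖aeval z (lacunaryPair c s L).2‖]
    simp only [p, map_mul, aeval_C, norm_mul, norm_algebraMap']
    norm_num
    linarith
  obtain ⟨B, h, hB, hh, hBh⟩ := exists_isFiniteBlaschkeProduct_of_polynomial (n := n)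
    (by lia) hp
  refine ⟨B, hB, le_trans (ENNReal.ofReal_le_ofReal ?_)
    (ofReal_sum_coeff_le_derivIntegral (L := L) (fun j hj => ?_) hh hBh)⟩
  · have hcoeff : ∀ j ∈ Finset.range L, ‖(p.map (algebraMap ℝ ℂ)).coeff (4 ^ j)‖ =
        1 / 2 * (s * c ^ (L - 1)) := fun j hj => by
      rw [coeff_map, norm_algebraMap', coeff_C_mul,
        lacunaryPair.coeff_fst c s (Finset.mem_range.1 hj), Real.norm_of_nonneg (by positivity)]
    rw [Finset.sum_congr rfl hcoeff, Finset.sum_const, Finset.card_range, nsmul_eq_mul]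
    have := sqrt_succ_le_mul_inv_sqrt hL
    simp only [s, c]
    linarith
  · have : 4 * 4 ^ j ≤ 4 ^ L := by
      rw [← pow_succ']
      exact Nat.pow_le_pow_right (by norm_num) hj
    lia

theorem one_add_sqrt_log_le (n : ℕ) (hn : 1 ≤ n) :
    1 + √(Real.log n) ≤ 3 * √(Nat.log 4 n + 1) := by
  have hs : 1 ≤ √((Nat.log 4 n : ℝ) + 1) := by
    rw [Real.one_le_sqrt]
    linarith [(Nat.log 4 n).cast_nonneg (α := ℝ)]
  have hlog4 : Real.log 4 ≤ 4 := (Real.log_le_sub_one_of_pos (by norm_num)).trans (by norm_num)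
  have hlog : Real.log n ≤ 2 ^ 2 * (Nat.log 4 n + 1) := by
    have h : (n : ℝ) ≤ 4 ^ (Nat.log 4 n + 1) := by
      exact_mod_cast (Nat.lt_pow_succ_log_self (by norm_num) n).le
    have hn' : (0 : ℝ) < n := by exact_mod_cast hn
    calc Real.log n ≤ Real.log (4 ^ (Nat.log 4 n + 1)) := Real.log_le_log hn' h
      _ = (Nat.log 4 n + 1) * Real.log 4 := by
          rw [Real.log_pow]
          push_cast
          ring
      _ ≤ (Nat.log 4 n + 1) * 2 ^ 2 := by
          gcongr
          linarith
      _ = _ := mul_comm _ _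
  have h2 : √(Real.log n) ≤ 2 * √(Nat.log 4 n + 1) := by
    refine (Real.sqrt_le_sqrt hlog).trans ?_
    rw [Real.sqrt_mul (by positivity), Real.sqrt_sq (by norm_num)]
  linarith

theorem theorem1 :
    (∀ n : ℕ, 1 ≤ n → ∀ B : ℂ → ℂ, IsFiniteBlaschkeProduct n B →
      derivIntegral B ≤ ENNReal.ofReal (Real.pi * (1 + Real.sqrt (Real.log n)))) ∧
    (∃ c : ℝ, 0 < c ∧ ∀ n : ℕ, 1 ≤ n → ∃ B : ℂ → ℂ, IsFiniteBlaschkeProduct n B ∧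
      ENNReal.ofReal (c * (1 + Real.sqrt (Real.log n))) ≤ derivIntegral B) := by
  refine ⟨fun n hn B hB => (hB.derivIntegral_le hn).trans (ENNReal.ofReal_le_ofReal ?_),
    -- `1/64` is `3/64` divided by the `3` of `one_add_sqrt_log_le`. For `n < 4` the monomial `z ^
    -- n` suffices, as `3/64 ≤ 3/8`.
    1 / 64, by norm_num, fun n hn => ?_⟩
  · exact le_mul_of_one_le_left (by positivity) (by linarith [Real.pi_gt_three])
  · have hle := one_add_sqrt_log_le n hn
    rcases lt_or_ge n 4 with h4 | h4
    · refine ⟨_, isFiniteBlaschkeProduct_pow n,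
        (ENNReal.ofReal_le_ofReal ?_).trans (le_derivIntegral_pow hn)⟩
      rw [Nat.log_of_lt h4] at hle
      norm_num at hle
      linarith
    · obtain ⟨B, hB, hI⟩ := exists_isFiniteBlaschkeProduct_le_derivIntegral h4
      exact ⟨B, hB, (ENNReal.ofReal_le_ofReal (by linarith)).trans hI⟩
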